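/- Let $T\ge 1$ be an integer. A $T$-periodic configuration $\mathbf X$ is the family of points $x_i+kT$ ($1\le i\le T$, $k\in\mathbb Z$), listed with multiplicity, where $0\le x_1\le\dots\le x_T<T$. Let $\mathrm d[\mathbf X]$ be the minimal distance between two distinctly labelled points of this family, and for $l\in(0,1]$ let $\mathbb X_T^{l}$ be the set of $T$-periodic configurations with $\mathrm d[\mathbf X]\ge l$. Let $u[\mathbf X]:\mathbb R\to\mathbb R$ be the $T$-periodic locally integrable function, unique up to an additive constant, whose distributional derivative is $$\mathrm Du[\mathbf X]=\mathcal L^1-\sum_{i=1}^{T}\sum_{k\in\mathbb Z}\delta_{x_i+kT}.$$ For $p\ge1$, $s\in(0,1)$ and a $T$-periodic measurable $u$ put $$\mathcal F^s_p(u)=\int_0^T\int_{\mathbb R}\frac{|u(x)-u(y)|^p}{|x-y|^{1+sp}}\,\mathrm dy\,\mathrm dx\in[0,+\infty].$$ Let $\rho\in C^\infty(\mathbb R)$ be a mollifier: $\rho\ge0$, $\int_{\mathbb R}\rho=1$, and $\rho=0$ outside $(-1,1)$. For $\varepsilon>0$ set $\rho_\varepsilon(x)=\varepsilon^{-1}\rho(x/\varepsilon)$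 and $\mathcal F^{s,\varepsilon}_p[\mathbf X]=\mathcal F^s_p(u[\mathbf X]*\rho_\varepsilon)$. Let $\mathbf X^{\mathrm{eq}}$ be the equispaced configuration, with $x_i=i-1$ for $1\le i\le T$. **Theorem.** Let $p\ge1$ and $s\in(0,1)$ with $sp\ge1$, and let $0<\varepsilon\le\frac14$. Then $\mathbf X^{\mathrm{eq}}\in\mathbb X_T^{4\varepsilon}$, and $\mathbf X^{\mathrm{eq}}$ minimises $\mathcal F^{s,\varepsilon}_p$ over $\mathbb X_T^{4\varepsilon}$. It is the unique minimiser up to translations: a configuration $\mathbf X\in\mathbb X_T^{4\varepsilon}$ minimises $\mathcal F^{s,\varepsilon}_p$ over $\mathbb X_T^{4\varepsilon}$ if and only if $\mathbf X=\mathbf X^{\mathrm{eq}}+a$ for some $a\in\mathbb R$. -/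

import Mathlib

open MeasureTheory Set
open scoped ContDiff ENNReal

/-- A `T`-periodic configuration, given by its ordered representative
`x₁ ≤ … ≤ x_T` in `[0,T)` (points may overlap). -/
structure Configuration (T : ℕ) where
  x : Fin T → ℝ
  mono : Monotone x
  mem : ∀ i, x i ∈ Ico (0 : ℝ) T

namespace Configuration

variable {T : ℕ}

/-- The points `x_i + kT` of the periodic configuration, listed with multiplicity. -/
def point (X : Configuration T) (a : Fin T × ℤ) : ℝ := X.x a.1 + a.2 * T

/-- The minimal distance `d[X]` between two distinctly labelled points of the configuration
(so it is `0` when two points overlap). -/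
noncomputable def minDist (X : Configuration T) : ℝ :=
  sInf {r : ℝ | ∃ a b : Fin T × ℤ, a ≠ b ∧ r = |X.point a - X.point b|}

/-- The class of `l`-regular configurations. -/
def regular (T : ℕ) (l : ℝ) : Set (Configuration T) := {X | l ≤ X.minDist}

/-- The equispaced configuration `ℤ`, with representative `(0, 1, …, T - 1)`. -/
def equispaced (T : ℕ) : Configuration T where
  x i := (i : ℕ)
  mono i j h := Nat.cast_le.2 (Fin.le_def.1 h)
  mem i := ⟨Nat.cast_nonneg _, by exact_mod_cast i.2⟩

/-- `X = Y + a` for some real `a`, as periodic point configurations with multiplicity. -/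
def IsTranslate (X Y : Configuration T) : Prop :=
  ∃ (a : ℝ) (e : Fin T × ℤ ≃ Fin T × ℤ), ∀ b, X.point (e b) = Y.point b + a

/-- `u` is a `T`-periodic locally integrable function whose distributional derivative is
`Du = 𝓛¹ - ∑_{i,k} δ_{x_i + kT}`. -/
structure IsDisplacement (X : Configuration T) (u : ℝ → ℝ) : Prop where
  locallyIntegrable : LocallyIntegrable u
  periodic : ∀ᵐ x : ℝ, u (x + T) = u x
  weakDeriv : ∀ φ : ℝ → ℝ, ContDiff ℝ ∞ φ → HasCompactSupport φ →
    -∫ x, u x * deriv φ x = (∫ x, φ x) - ∑ i, ∑' k : ℤ, φ (X.point (i, k))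

theorem integral_floor_mul_deriv {c τ : ℝ} (hτ : 0 < τ) {φ : ℝ → ℝ} (hφ : ContDiff ℝ ∞ φ)
    (hc : HasCompactSupport φ) :
    ∫ x, (⌊(x - c) / τ⌋ : ℝ) * deriv φ x = -∑' k : ℤ, φ (c + k * τ) := by
  have hd : Continuous (deriv φ) := hφ.continuous_deriv (by simp)
  have hdi : Integrable (deriv φ) := hd.integrable_of_hasCompactSupport hc.deriv
  have h1 : ContDiff ℝ 1 φ := hφ.of_le (by simp)
  obtain ⟨R, hR⟩ := hc.isCompact.isBounded.exists_norm_le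
  obtain ⟨N, hN⟩ := exists_nat_gt ((R + |c|) / τ)
  rw [div_lt_iff₀ hτ] at hN
  have key : ∀ x ∈ tsupport φ, -(N : ℝ) < (x - c) / τ ∧ (x - c) / τ < N := by
    intro x hx
    have h := abs_le.1 (hR x hx)
    have h2 := abs_le.1 (le_refl |c|)
    rw [lt_div_iff₀ hτ, div_lt_iff₀ hτ]
    constructor <;> linarith
  have hsum : ∑' k : ℤ, φ (c + k * τ) = ∑ k ∈ Finset.Ioc (-(N : ℤ)) N, φ (c + k * τ) := by
    apply tsum_eq_sum
    intro k hk
    by_contra h0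
    have h := key _ (subset_tsupport _ h0)
    rw [add_sub_cancel_left, mul_div_cancel_right₀ _ hτ.ne'] at h
    apply hk
    rw [Finset.mem_Ioc]
    exact ⟨by exact_mod_cast h.1, by exact_mod_cast h.2.le⟩
  have hpt : ∀ x, (⌊(x - c) / τ⌋ : ℝ) * deriv φ x = -(N : ℝ) * deriv φ x +
      ∑ k ∈ Finset.Ioc (-(N : ℤ)) N, (Ici (c + k * τ)).indicator (deriv φ) x := by
    intro x
    by_cases hx : x ∈ tsupport φ
    · obtain ⟨ha, hb⟩ := key x hx
      have hm1 : -(N : ℤ) ≤ ⌊(x - c) / τ⌋ := Int.le_floor.2 (by push_cast; exact ha.le)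
      have hm2 : ⌊(x - c) / τ⌋ < (N : ℤ) := Int.floor_lt.2 (by exact_mod_cast hb)
      have hi : ∀ k : ℤ, (Ici (c + k * τ)).indicator (deriv φ) x =
          if k ≤ ⌊(x - c) / τ⌋ then deriv φ x else 0 := by
        intro k
        have : x ∈ Ici (c + k * τ) ↔ k ≤ ⌊(x - c) / τ⌋ := by
          rw [Int.le_floor, le_div_iff₀ hτ, mem_Ici]
          constructor <;> intro h <;> linarith
        simp only [indicator_apply, this]
      simp only [hi]
      rw [← Finset.sum_filter, Finset.sum_const]
      have hf : (Finset.Ioc (-(N : ℤ)) N).filter (fun k => k ≤ ⌊(x - c) / τ⌋) =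
          Finset.Ioc (-(N : ℤ)) ⌊(x - c) / τ⌋ := by
        ext k
        simp only [Finset.mem_filter, Finset.mem_Ioc]
        omega
      rw [hf, Int.card_Ioc, nsmul_eq_mul]
      have : (((⌊(x - c) / τ⌋ - -(N : ℤ)).toNat : ℕ) : ℝ) = (⌊(x - c) / τ⌋ : ℝ) + N := by
        have : (((⌊(x - c) / τ⌋ - -(N : ℤ)).toNat : ℕ) : ℤ) = ⌊(x - c) / τ⌋ + N := by omega
        exact_mod_cast this
      rw [this]
      ring
    · have h0 : deriv φ x = 0 := by
        by_contra h
        exact hx (support_deriv_subset h)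
      simp [indicator_apply, h0]
  simp only [hpt]
  rw [integral_add (hdi.const_mul _) (integrable_finsetSum _ fun k _ =>
      hdi.indicator measurableSet_Ici), integral_const_mul,
    integral_finsetSum _ fun k _ => hdi.indicator measurableSet_Ici, hsum,
    ← Finset.sum_neg_distrib,
    integral_eq_zero_of_hasDerivAt_of_integrable
      (fun x => (h1.differentiable (by simp) x).hasDerivAt) hdi
      (h1.continuous.integrable_of_hasCompactSupport hc), mul_zero, zero_add]
  refine Finset.sum_congr rfl fun k _ => ?_
  rw [integral_indicator measurableSet_Ici, integral_Ici_eq_integral_Ioi,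
    hc.integral_Ioi_deriv_eq h1]

/-- Displacements exist: `x ↦ x - ∑ i, ⌊(x - x_i) / T⌋` is one. -/
theorem exists_isDisplacement (X : Configuration T) : ∃ u, X.IsDisplacement u := by
  have hT : ∀ _ : Fin T, (0 : ℝ) < T := fun i => by exact_mod_cast i.pos
  have hmono : ∀ i : Fin T, Monotone fun x : ℝ => (⌊(x - X.x i) / T⌋ : ℝ) := by
    intro i x y hxy
    have h := hT i
    have : ⌊(x - X.x i) / T⌋ ≤ ⌊(y - X.x i) / T⌋ := by gcongr
    exact Int.cast_le.2 this
  have hli : ∀ i : Fin T, LocallyIntegrable fun x : ℝ => (⌊(x - X.x i) / T⌋ : ℝ) :=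
    fun i => (hmono i).locallyIntegrable
  refine ⟨fun x => x - ∑ i, (⌊(x - X.x i) / T⌋ : ℝ), ?_, ?_, ?_⟩
  · exact continuous_id.locallyIntegrable.sub (locallyIntegrable_finsetSum _ fun i _ => hli i)
  · refine Filter.Eventually.of_forall fun x => ?_
    have : ∀ i : Fin T, (⌊(x + T - X.x i) / T⌋ : ℝ) = (⌊(x - X.x i) / T⌋ : ℝ) + 1 := by
      intro i
      have : (x + T - X.x i) / T = (x - X.x i) / T + 1 := by
        have := (hT i).ne'
        field_simp
        ring
      rw [this, Int.floor_add_one]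
      push_cast
      ring
    simp only [this, Finset.sum_add_distrib, Finset.sum_const, Finset.card_univ,
      Fintype.card_fin, nsmul_eq_mul]
    ring
  · intro φ hφ hc
    have hd : Continuous (deriv φ) := hφ.continuous_deriv (by simp)
    have h1 : ContDiff ℝ 1 φ := hφ.of_le (by simp)
    have hint : ∀ i : Fin T, Integrable fun x => (⌊(x - X.x i) / T⌋ : ℝ) * deriv φ x := by
      intro i
      simpa [mul_comm] using
        (hli i).integrable_smul_left_of_hasCompactSupport hd hc.deriv
    have hx : Integrable fun x : ℝ => x * deriv φ x :=
      (continuous_id.mul hd).integrable_of_hasCompactSupport hc.deriv.mul_left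
    have hφi : Integrable φ := h1.continuous.integrable_of_hasCompactSupport hc
    have hibp : ∫ x : ℝ, x * deriv φ x = -∫ x, φ x := by
      have := integral_mul_deriv_eq_deriv_mul_of_integrable (u := fun x : ℝ => x)
        (u' := fun _ => 1) (v := φ) (v' := deriv φ) (fun x _ => hasDerivAt_id x)
        (fun x _ => (h1.differentiable (by simp) x).hasDerivAt) hx
        (by simpa [Pi.mul_def] using hφi)
        ((continuous_id.mul h1.continuous).integrable_of_hasCompactSupport hc.mul_left)
      simpa using this
    simp only [sub_mul, Finset.sum_mul]
    rw [integral_sub hx (integrable_finsetSum _ fun i _ => hint i),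
      integral_finsetSum _ fun i _ => hint i, hibp,
      Finset.sum_congr rfl fun i _ => integral_floor_mul_deriv (hT i) hφ hc]
    simp only [Finset.sum_neg_distrib, point]
    ring

/-- The function `u[X]`. It is determined by `X` up to an additive constant (and null sets),
on which the energies below do not depend. -/
noncomputable def displacement (X : Configuration T) : ℝ → ℝ :=
  Classical.choose X.exists_isDisplacement

end Configuration

/-- The periodic Gagliardo energy
`𝓕ˢₚ(u) = ∫_{[0,T]} ∫_ℝ |u(x) - u(y)|ᵖ / |x - y|^{1 + sp} dy dx ∈ [0, ∞]`. -/
noncomputable def gagliardoEnergy (T : ℕ) (s p : ℝ) (u : ℝ → ℝ) : ℝ≥0∞ :=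
  ∫⁻ x in Icc (0 : ℝ) T, ∫⁻ y : ℝ, ENNReal.ofReal (|u x - u y| ^ p / |x - y| ^ (1 + s * p))

/-- A smooth mollifier supported in `(-1,1)`; symmetry is not required. -/
structure IsMollifier (ρ : ℝ → ℝ) : Prop where
  contDiff : ContDiff ℝ ∞ ρ
  nonneg : ∀ x, 0 ≤ ρ x
  support_subset : Function.support ρ ⊆ Ioo (-1) 1
  integral_eq_one : ∫ x, ρ x = 1

/-- `u ∗ ρ_ε`, where `ρ_ε(x) = ε⁻¹ ρ(x / ε)`. -/
noncomputable def mollify (ρ : ℝ → ℝ) (ε : ℝ) (u : ℝ → ℝ) : ℝ → ℝ :=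
  convolution u (fun x => ε⁻¹ * ρ (x / ε)) (ContinuousLinearMap.mul ℝ ℝ) volume

/-- The mollified energy `𝓕^{s,ε}_p[X] = 𝓕ˢₚ(u[X] ∗ ρ_ε)`. -/
noncomputable def Configuration.mollifiedEnergy {T : ℕ} (s p : ℝ) (ρ : ℝ → ℝ) (ε : ℝ)
    (X : Configuration T) : ℝ≥0∞ :=
  gagliardoEnergy T s p (mollify ρ ε X.displacement)

open Filter

/-!
Slicing the double integral by the increment `h = y - x` writes `𝓕ˢₚ(v)` as a weighted integral
over `h` of the increment energies `∫₀ᵀ |v (x + h) - v x|ᵖ dx`, and the equispaced configuration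
minimises each of these separately. Let `z j` be the ordered points, `G = H ∗ ρ_ε` the mollified
Heaviside function, and fix an integer `n`. Matching the step at `z j` with the step at
`z (j + n)` gives `v (x + h) - v x = h - n - ∑ j, (G (x + h - z (j + n)) - G (x - z j))`.

Since the points are `2ε`-separated, steps do not overlap, and so all summands have the same
sign. A convex function vanishing at `0` is superadditive on numbers of equal sign, so the
energy is bounded below by a sum over one period of the costs of shifting `G` by
`h - (z (j + n) - z j)`. These shifts have mean `h - n` whatever the configuration, and the
cost is convex in the shift, in the sense of Wright, because `G` is monotone: by Jensen's
inequality the energy is least when all the shifts agree. For equispaced points and `n` the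
integer nearest to `h`, at most one summand is nonzero at each `x`, and both inequalities are
equalities.

A minimiser has the same increment energy as the equispaced configuration for every `h`, because
the energies are finite and continuous in `h`. At `h = n = 1` this energy vanishes, hence so
does the cost of each shift `1 - (z (j + 1) - z j)`, and all consecutive gaps are `1`.
-/

theorem convexOn_add_le_add {ψ : ℝ → ℝ} (hψ : ConvexOn ℝ univ ψ) {a b c d : ℝ} (hab : a ≤ b)
    (hbd : b ≤ d) (h : a + d = b + c) : ψ b + ψ c ≤ ψ a + ψ d := by
  obtain rfl | had := (hab.trans hbd).eq_or_lt
  · obtain rfl := le_antisymm hab hbd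
    obtain rfl := add_left_cancel h
    rfl
  have hpos : 0 < d - a := sub_pos.2 had
  have hsum : (d - b) / (d - a) + (b - a) / (d - a) = 1 := by field_simp; ring
  have hl : 0 ≤ (d - b) / (d - a) := div_nonneg (sub_nonneg.2 hbd) hpos.le
  have hr : 0 ≤ (b - a) / (d - a) := div_nonneg (sub_nonneg.2 hab) hpos.le
  have hb : b = (d - b) / (d - a) * a + (b - a) / (d - a) * d := by field_simp; ring
  have hc : c = (b - a) / (d - a) * a + (d - b) / (d - a) * d := by
    rw [eq_sub_of_add_eq' h.symm]; field_simp; ring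
  have key_b := hψ.2 (mem_univ a) (mem_univ d) hl hr hsum
  have key_c := hψ.2 (mem_univ a) (mem_univ d) hr hl (by rwa [add_comm])
  simp only [smul_eq_mul] at key_b key_c
  rw [← hb] at key_b
  rw [← hc] at key_c
  calc ψ b + ψ c
      ≤ ((d - b) / (d - a) + (b - a) / (d - a)) * (ψ a + ψ d) := by linarith
    _ = ψ a + ψ d := by rw [hsum, one_mul]

theorem sum_map_le_map_sum_of_nonneg {ψ : ℝ → ℝ} (hψ : ConvexOn ℝ univ ψ) (h0 : ψ 0 = 0)
    {ι : Type*} {b : ι → ℝ} (hb : ∀ i, 0 ≤ b i) (s : Finset ι) :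
    ∑ i ∈ s, ψ (b i) ≤ ψ (∑ i ∈ s, b i) := by
  classical
  induction s using Finset.induction_on with
  | empty => simp [h0]
  | insert i s hi ih =>
    rw [Finset.sum_insert hi, Finset.sum_insert hi]
    have hs : 0 ≤ ∑ j ∈ s, b j := Finset.sum_nonneg fun j _ => hb j
    have := convexOn_add_le_add hψ (hb i) (le_add_of_nonneg_right hs) (zero_add _)
    linarith

theorem tsum_map_le_map_tsum_of_nonneg {ψ : ℝ → ℝ} (hψ : ConvexOn ℝ univ ψ) (h0 : ψ 0 = 0)
    {ι : Type*} {b : ι → ℝ} (hfin : (Function.support b).Finite) (hb : ∀ i, 0 ≤ b i) :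
    ∑' i, ψ (b i) ≤ ψ (∑' i, b i) := by
  have hzero : ∀ i ∉ hfin.toFinset, b i = 0 := by simp
  rw [tsum_eq_sum hzero, tsum_eq_sum fun i hi => by rw [hzero i hi, h0]]
  exact sum_map_le_map_sum_of_nonneg hψ h0 hb _

theorem tsum_map_le_map_tsum_of_same_sign {ψ : ℝ → ℝ} (hψ : ConvexOn ℝ univ ψ) (h0 : ψ 0 = 0)
    {ι : Type*} {b : ι → ℝ} (hfin : (Function.support b).Finite)
    (hb : (∀ i, 0 ≤ b i) ∨ ∀ i, b i ≤ 0) : ∑' i, ψ (b i) ≤ ψ (∑' i, b i) := by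
  obtain hb | hb := hb
  · exact tsum_map_le_map_tsum_of_nonneg hψ h0 hfin hb
  · have hψ' : ConvexOn ℝ univ fun t => ψ (-t) := hψ.comp_linearMap (-LinearMap.id)
    simpa [tsum_neg] using tsum_map_le_map_tsum_of_nonneg (b := fun i => -b i) hψ' (by simpa)
      ((Function.support_neg b).symm ▸ hfin) fun i => neg_nonneg.2 (hb i)

theorem map_tsum_eq_tsum_map_of_subsingleton {ψ : ℝ → ℝ} (h0 : ψ 0 = 0) {ι : Type*} {b : ι → ℝ}
    (hb : (Function.support b).Subsingleton) : ψ (∑' i, b i) = ∑' i, ψ (b i) := by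
  obtain hb | ⟨i, hi⟩ := hb.eq_empty_or_singleton
  · simp [Function.support_eq_empty_iff.1 hb, h0]
  · have hzero : ∀ j, j ≠ i → b j = 0 := fun j hj => by
      simpa using (hi.symm ▸ hj : j ∉ Function.support b)
    rw [tsum_eq_single i hzero, tsum_eq_single i fun j hj => by rw [hzero j hj, h0]]

/-- Wright convexity: moving the endpoints of an interval towards each other by the same amount
does not increase the sum of the values of `f`. Unlike convexity, it is inherited directly by
integrals of translates, and for equal weights it is all that Jensen's inequality needs. -/
def IsWrightConvex (f : ℝ → ℝ) : Prop :=
  ∀ ⦃a b d : ℝ⦄, 0 ≤ d → a + d ≤ b → f (a + d) + f (b - d) ≤ f a + f b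

theorem IsWrightConvex.card_mul_le_sum {f : ℝ → ℝ} (hf : IsWrightConvex f) {ι : Type*}
    {m : ℝ} (s : Finset ι) (τ : ι → ℝ) (hτ : ∑ i ∈ s, τ i = s.card * m) :
    s.card * f m ≤ ∑ i ∈ s, f (τ i) := by
  classical
  induction hn : s.card generalizing s τ with
  | zero => simp [Finset.card_eq_zero.1 hn]
  | succ n ih =>
    have hne : s.Nonempty := Finset.card_pos.1 (by lia)
    obtain ⟨i, hi, him⟩ := Finset.exists_le_of_sum_le (f := τ) (g := fun _ => m) hne (by simp [hτ])
    have hcard : (s.erase i).card = n := by rw [Finset.card_erase_of_mem hi, hn]; rfl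
    have hsum : τ i + ∑ j ∈ s.erase i, τ j = (n + 1) * m := by
      rw [Finset.add_sum_erase _ _ hi, hτ, hn]; push_cast; rfl
    rw [← Finset.add_sum_erase _ _ hi]
    push_cast
    obtain hempty | hne' := (s.erase i).eq_empty_or_nonempty
    · obtain rfl : n = 0 := by simpa [hempty] using hcard.symm
      simp only [hempty, Finset.sum_empty] at hsum ⊢
      have : τ i = m := by simpa using hsum
      simp [this]
    obtain ⟨j, hj, hmj⟩ := Finset.exists_le_of_sum_le (f := fun _ => m) (g := τ) hne'
      (by rw [Finset.sum_const, hcard, nsmul_eq_mul]; linarith)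
    -- move `τ i` to the mean and let `τ j` absorb the difference
    have hswap : f m + f (τ i + τ j - m) ≤ f (τ i) + f (τ j) := by
      convert hf (sub_nonneg.2 him) (by linarith : τ i + (m - τ i) ≤ τ j) using 3 <;> ring
    have hupd : ∀ g : ℝ → ℝ, ∑ k ∈ s.erase i, g (Function.update τ j (τ i + τ j - m) k) =
        (∑ k ∈ s.erase i, g (τ k)) - g (τ j) + g (τ i + τ j - m) := fun g => by
      rw [← Finset.add_sum_erase _ _ hj, ← Finset.add_sum_erase _ _ hj, Function.update_self,
        Finset.sum_congr rfl fun k hk => by rw [Function.update_of_ne (Finset.ne_of_mem_erase hk)]]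
      ring
    have := ih (s.erase i) (Function.update τ j (τ i + τ j - m))
      (by rw [hcard, hupd fun t => t]; linarith) hcard
    rw [hupd f] at this
    linarith

theorem hasSum_intervalIntegral_comp_sub_mul {f : ℝ → ℝ} (hf : Integrable f) {T : ℝ}
    (hT : 0 < T) : HasSum (fun k : ℤ => ∫ x in (0 : ℝ)..T, f (x - k * T)) (∫ x, f x) := by
  have hint : ∀ k : ℤ, ∫ x in (0 : ℝ)..T, f (x - (-k : ℤ) * T) =
      ∫ x in Ioc (0 + k • T) (0 + (k + 1) • T), f x := fun k => by
    rw [intervalIntegral.integral_comp_sub_right, intervalIntegral.integral_of_le (by linarith)]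
    simp only [zsmul_eq_mul]
    push_cast
    ring_nf
  rw [← (Equiv.neg ℤ).hasSum_iff, ← setIntegral_univ, ← iUnion_Ioc_add_zsmul hT 0]
  simp only [Function.comp_def, Equiv.neg_apply, hint]
  exact hasSum_integral_iUnion (fun _ => measurableSet_Ioc)
    (pairwise_disjoint_Ioc_add_zsmul 0 T) hf.integrableOn

theorem locallyFinite_of_tendsto_cocompact {ι E : Type*} [PseudoMetricSpace E] [ProperSpace E]
    {z : ι → E} (hz : Tendsto z cofinite (cocompact E)) {R : ℝ} {s : ι → Set E}
    (hs : ∀ j, s j ⊆ Metric.closedBall (z j) R) : LocallyFinite s := by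
  intro x
  have hfin : (z ⁻¹' Metric.closedBall x (R + 1)).Finite := by
    simpa only [mem_map, mem_cofinite, preimage_compl, compl_compl] using
      hz (isCompact_closedBall x (R + 1)).compl_mem_cocompact
  refine ⟨_, Metric.ball_mem_nhds x one_pos, hfin.subset ?_⟩
  rintro j ⟨y, hyj, hyx⟩
  change dist (z j) x ≤ R + 1
  calc dist (z j) x
    _ ≤ dist y (z j) + dist y x := dist_triangle_left _ _ _
    _ ≤ R + 1 := add_le_add (hs j hyj) (Metric.mem_ball.1 hyx).le

section LocallyFinite

variable {ι : Type*} {f : ι → ℝ → ℝ}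

theorem continuous_tsum_of_locallyFinite (hc : ∀ j, Continuous (f j))
    (hf : LocallyFinite fun j => Function.support (f j)) : Continuous fun x => ∑' j, f j x := by
  have : ∀ x, (fun j => f j x).HasFiniteSupport := hf.point_finite
  simpa only [tsum_eq_finsum (this _)] using continuous_finsum hc hf

theorem hasSum_intervalIntegral_of_locallyFinite (hc : ∀ j, Continuous (f j))
    (hf : LocallyFinite fun j => Function.support (f j)) (a b : ℝ) :
    HasSum (fun j => ∫ x in a..b, f j x) (∫ x in a..b, ∑' j, f j x) := by
  have hfin := hf.finite_nonempty_inter_compact (isCompact_uIcc (a := a) (b := b))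
  have hzero : ∀ j ∉ hfin.toFinset, ∀ x ∈ uIcc a b, f j x = 0 := by
    intro j hj x hx
    by_contra h
    exact hj (hfin.mem_toFinset.2 ⟨x, h, hx⟩)
  have hsum : ∫ x in a..b, ∑' j, f j x = ∑ j ∈ hfin.toFinset, ∫ x in a..b, f j x := by
    rw [← intervalIntegral.integral_finsetSum fun j _ => (hc j).intervalIntegrable a b]
    exact intervalIntegral.integral_congr fun x hx => tsum_eq_sum fun j hj => hzero j hj x hx
  rw [hsum]
  refine hasSum_sum_of_ne_finset_zero fun j hj => ?_
  simpa using intervalIntegral.integral_congr (μ := volume) (hzero j hj)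

end LocallyFinite

theorem hasSum_int_succ_sub {a : ℤ → ℝ} {c₁ c₂ : ℝ} (hbot : ∀ᶠ j in atBot, a j = c₁)
    (htop : ∀ᶠ j in atTop, a j = c₂) : HasSum (fun j => a (j + 1) - a j) (c₂ - c₁) := by
  obtain ⟨m, hm⟩ := eventually_atBot.1 hbot
  obtain ⟨M, hM⟩ := eventually_atTop.1 htop
  let N := m.natAbs + M.natAbs
  have hsum : ∑ j ∈ Finset.Ico (-N : ℤ) N, (a (j + 1) - a j) = c₂ - c₁ := by
    rw [← hm (-N) (by lia), ← hM N (by lia), ← neg_inj, ← Finset.sum_neg_distrib]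
    simpa using Finset.sum_Ico_int_sub N a
  rw [← hsum]
  refine hasSum_sum_of_ne_finset_zero fun j hj => ?_
  obtain h | h : j < -N ∨ N ≤ j := by simpa [imp_iff_not_or] using hj
  · rw [hm j (by lia), hm (j + 1) (by lia), sub_self]
  · rw [hM j (by lia), hM (j + 1) (by lia), sub_self]

theorem hasSum_int_add_sub {a : ℤ → ℝ} {c₁ c₂ : ℝ} (hbot : ∀ᶠ j in atBot, a j = c₁)
    (htop : ∀ᶠ j in atTop, a j = c₂) (n : ℤ) :
    HasSum (fun j => a (j + n) - a j) (n * (c₂ - c₁)) := by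
  have hstep : ∀ n : ℤ, HasSum (fun j => a (j + (n + 1)) - a (j + n)) (c₂ - c₁) := fun n => by
    simpa only [Function.comp_def, Equiv.coe_addRight, add_assoc] using
      (Equiv.addRight n).hasSum_iff.2 (hasSum_int_succ_sub hbot htop)
  induction n using Int.induction_on with
  | zero => simp
  | succ n ih =>
    simpa [add_mul, add_comm, add_sub_cancel] using ih.add (hstep n)
  | pred n ih =>
    have := ih.sub (hstep (-n - 1))
    simp only [sub_add_cancel, sub_sub_sub_cancel_left] at this
    simpa [sub_mul] using this

theorem continuous_of_convexOn_univ {φ : ℝ → ℝ} (hφ : ConvexOn ℝ univ φ) : Continuous φ :=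
  continuousOn_univ.1 (hφ.continuousOn isOpen_univ)

/-- `G` is a continuous step of width `2ε` at the origin: it rises monotonically from `0` to `1`
on `[-ε, ε]` and is constant elsewhere. -/
structure IsTransition (ε : ℝ) (G : ℝ → ℝ) : Prop where
  continuous : Continuous G
  monotone : Monotone G
  eq_zero : ∀ x, x ≤ -ε → G x = 0
  eq_one : ∀ x, ε ≤ x → G x = 1

namespace IsTransition

variable {ε : ℝ} {G : ℝ → ℝ}

theorem nonneg (hG : IsTransition ε G) (x : ℝ) : 0 ≤ G x := by
  rw [← hG.eq_zero (min x (-ε)) (min_le_right _ _)]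
  exact hG.monotone (min_le_left _ _)

theorem le_one (hG : IsTransition ε G) (x : ℝ) : G x ≤ 1 := by
  rw [← hG.eq_one (max x ε) (le_max_right _ _)]
  exact hG.monotone (le_max_left _ _)

theorem shift_sub_eq_zero (hG : IsTransition ε G) {a b x : ℝ} (hx : ε + |a - b| ≤ |x - b|) :
    G (x - a) - G (x - b) = 0 := by
  have hle := le_abs_self (a - b)
  have hge := neg_abs_le (a - b)
  obtain hx | hx := le_abs.1 hx
  · rw [hG.eq_one _ (by linarith), hG.eq_one _ (by linarith [abs_nonneg (a - b)]), sub_self]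
  · rw [hG.eq_zero _ (by linarith), hG.eq_zero _ (by linarith [abs_nonneg (a - b)]), sub_self]

theorem support_shift_sub_subset (hG : IsTransition ε G) (a b : ℝ) :
    Function.support (fun x => G (x - a) - G (x - b)) ⊆ Metric.closedBall b (ε + |a - b|) := by
  intro x hx
  rw [Metric.mem_closedBall, Real.dist_eq]
  exact le_of_not_ge fun h => hx (hG.shift_sub_eq_zero h)

theorem locallyFinite_support_shift_sub (hG : IsTransition ε G) {ι : Type*} {a b : ι → ℝ} {C : ℝ}
    (hb : Tendsto b cofinite (cocompact ℝ)) (hab : ∀ j, |a j - b j| ≤ C) :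
    LocallyFinite fun j => Function.support fun x => G (x - a j) - G (x - b j) :=
  locallyFinite_of_tendsto_cocompact hb fun j =>
    (hG.support_shift_sub_subset (a j) (b j)).trans
      (Metric.closedBall_subset_closedBall (add_le_add_right (hab j) ε))

theorem eq_zero_of_periodic (hG : IsTransition ε G) {τ : ℝ} (hτ : Function.Periodic G τ) :
    τ = 0 := by
  have not_pos : ∀ {c : ℝ}, Function.Periodic G c → ¬ 0 < c := fun hc hpos => by
    obtain ⟨y, hy, hGy⟩ := hc.exists_mem_Ico hpos (-ε) ε
    rw [hG.eq_zero _ le_rfl, hG.eq_one _ hy.1] at hGy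
    exact zero_ne_one hGy
  exact le_antisymm (not_lt.1 (not_pos hτ)) (neg_nonpos.1 (not_lt.1 (not_pos hτ.neg)))

end IsTransition

/-- The cost `∫ ψ (G (x + τ) - G x) dx` of translating the profile `G` by `τ`. -/
noncomputable def shiftCost (ψ G : ℝ → ℝ) (τ : ℝ) : ℝ := ∫ x, ψ (G (x + τ) - G x)

section ShiftCost

variable {ε : ℝ} {ψ G : ℝ → ℝ}

theorem IsTransition.hasCompactSupport_shift_sub (hG : IsTransition ε G) (h0 : ψ 0 = 0)
    (a b : ℝ) : HasCompactSupport fun x => ψ (G (x - a) - G (x - b)) :=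
  (HasCompactSupport.of_support_subset_isCompact (isCompact_closedBall _ _)
    (hG.support_shift_sub_subset a b)).comp_left h0

theorem IsTransition.continuous_shift_sub (hG : IsTransition ε G) (hψ : Continuous ψ) (a b : ℝ) :
    Continuous fun x => ψ (G (x - a) - G (x - b)) := by
  have := hG.continuous
  fun_prop

theorem IsTransition.integrable_shift_sub (hG : IsTransition ε G) (hψ : Continuous ψ)
    (h0 : ψ 0 = 0) (a b : ℝ) : Integrable fun x => ψ (G (x - a) - G (x - b)) :=
  (hG.continuous_shift_sub hψ a b).integrable_of_hasCompactSupport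
    (hG.hasCompactSupport_shift_sub h0 a b)

theorem integral_shift_sub (ψ G : ℝ → ℝ) (a b : ℝ) :
    ∫ x, ψ (G (x - a) - G (x - b)) = shiftCost ψ G (b - a) := by
  simpa only [shiftCost, sub_add_sub_cancel] using
    integral_sub_right_eq_self (μ := volume) (fun x => ψ (G (x + (b - a)) - G x)) b

theorem IsTransition.isWrightConvex_shiftCost (hG : IsTransition ε G) (hψ : ConvexOn ℝ univ ψ)
    (h0 : ψ 0 = 0) : IsWrightConvex (shiftCost ψ G) := by
  intro a b d hd hab
  have hint := hG.integrable_shift_sub (continuous_of_convexOn_univ hψ) h0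
  have ha : shiftCost ψ G a = ∫ x, ψ (G (x - (-a - d)) - G (x - (-d))) := by
    rw [integral_shift_sub]; congr 1; ring
  have hb : shiftCost ψ G b = ∫ x, ψ (G (x - (-b)) - G (x - 0)) := by
    rw [integral_shift_sub]; congr 1; ring
  have had : shiftCost ψ G (a + d) = ∫ x, ψ (G (x - (-a - d)) - G (x - 0)) := by
    rw [integral_shift_sub]; congr 1; ring
  have hbd : shiftCost ψ G (b - d) = ∫ x, ψ (G (x - (-b)) - G (x - (-d))) := by
    rw [integral_shift_sub]; congr 1; ring
  rw [ha, hb, had, hbd, ← integral_add (hint _ _) (hint _ _), ← integral_add (hint _ _) (hint _ _)]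
  refine integral_mono ((hint _ _).add (hint _ _)) ((hint _ _).add (hint _ _)) fun x => ?_
  have hleft : G (x - (-a - d)) ≤ G (x - (-b)) := hG.monotone (by linarith)
  have hright : G (x - 0) ≤ G (x - (-d)) := hG.monotone (by linarith)
  exact convexOn_add_le_add hψ (by linarith) (by linarith) (by ring)

theorem IsTransition.eq_zero_of_shiftCost_eq_zero (hG : IsTransition ε G) (hψ : Continuous ψ)
    (hnonneg : ∀ t, 0 ≤ ψ t) (hzero : ∀ t, ψ t = 0 ↔ t = 0) {τ : ℝ}
    (hτ : shiftCost ψ G τ = 0) : τ = 0 := by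
  refine hG.eq_zero_of_periodic fun x => ?_
  by_contra hne
  refine (Continuous.integral_pos_of_hasCompactSupport_nonneg_nonzero (μ := volume) (x := x)
    (hG.continuous_shift_sub hψ (-τ) 0) (hG.hasCompactSupport_shift_sub ((hzero 0).2 rfl) _ _)
    (fun _ => hnonneg _) ?_).ne' ?_
  · simpa [hzero, sub_eq_zero] using hne
  · rw [integral_shift_sub, zero_sub, neg_neg, hτ]

end ShiftCost

/-- `z` commutes with the translations by `T` of `ℤ` and of `ℝ`: it lists the points of a
`T`-periodic family with `T` points per period. -/
def IsQuasiPeriodic (T : ℕ) (z : ℤ → ℝ) : Prop := ∀ j, z (j + T) = z j + T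

theorem isQuasiPeriodic_intCast (T : ℕ) : IsQuasiPeriodic T (fun j => (j : ℝ)) := fun j => by
  push_cast; rfl

/-- The labelling of the points of a `T`-periodic family by the integers `k T + i`. -/
def labelEquiv (T : ℕ) [NeZero T] : ℤ ≃ Fin T × ℤ :=
  (Int.divModEquiv T).trans (Equiv.prodComm _ _)

theorem labelEquiv_symm_apply {T : ℕ} [NeZero T] (b : Fin T × ℤ) :
    (labelEquiv T).symm b = b.2 * T + (b.1 : ℕ) := rfl

namespace IsQuasiPeriodic

variable {T : ℕ} {z : ℤ → ℝ}

theorem periodic_sub (hz : IsQuasiPeriodic T z) :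
    Function.Periodic (fun j => z j - j) (T : ℤ) := fun j => by
  simp only [hz j]; push_cast; ring

theorem add_mul_period (hz : IsQuasiPeriodic T z) (j k : ℤ) :
    z (j + k * T) = z j + k * T := by
  have := hz.periodic_sub.int_mul k j
  push_cast at this
  linarith

theorem sum_shift_sub (hz : IsQuasiPeriodic T z) (n : ℤ) :
    ∑ i : Fin T, (z ((i : ℕ) + n) - z (i : ℕ)) = T * n := by
  have hstep : ∀ n : ℤ, ∑ i : Fin T, (z ((i : ℕ) + (n + 1)) - z ((i : ℕ) + n)) = T := fun n => by
    have htel := Finset.sum_range_sub (fun i : ℕ => z (i + n)) T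
    rw [Nat.cast_zero, zero_add, add_comm (T : ℤ), hz n, add_sub_cancel_left,
      Finset.sum_range] at htel
    simpa only [Nat.cast_add, Nat.cast_one, add_assoc, add_comm 1 n] using htel
  simp only [Finset.sum_sub_distrib] at hstep ⊢
  induction n using Int.induction_on with
  | zero => simp
  | succ n ih => push_cast at ih ⊢; linarith [hstep n]
  | pred n ih =>
    have := hstep (-n - 1)
    rw [sub_add_cancel] at this
    push_cast at ih ⊢
    linarith

variable [NeZero T]

theorem exists_abs_sub_le (hz : IsQuasiPeriodic T z) : ∃ C, ∀ j : ℤ, |z j - j| ≤ C := by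
  obtain ⟨C, hC⟩ := ((finite_Ico (0 : ℤ) T).image fun j => |z j - j|).bddAbove
  refine ⟨C, fun j => ?_⟩
  obtain ⟨i, hi, hij⟩ := hz.periodic_sub.exists_mem_Ico₀ (by simp [NeZero.pos]) j
  exact hij ▸ hC ⟨i, hi, rfl⟩

theorem tendsto_atTop (hz : IsQuasiPeriodic T z) : Tendsto z atTop atTop := by
  obtain ⟨C, hC⟩ := hz.exists_abs_sub_le
  exact tendsto_atTop_mono (fun j => by linarith [neg_le_of_abs_le (hC j)])
    (tendsto_atTop_add_const_right atTop (-C) tendsto_intCast_atTop_atTop)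

theorem tendsto_atBot (hz : IsQuasiPeriodic T z) : Tendsto z atBot atBot := by
  obtain ⟨C, hC⟩ := hz.exists_abs_sub_le
  exact tendsto_atBot_mono (fun j : ℤ => (by linarith [le_of_abs_le (hC j)] : z j ≤ j + C))
    (tendsto_atBot_add_const_right atBot C (tendsto_intCast_atBot_iff.2 tendsto_id))

theorem tendsto_cofinite (hz : IsQuasiPeriodic T z) : Tendsto z cofinite (cocompact ℝ) := by
  rw [Int.cofinite_eq, cocompact_eq_atBot_atTop]
  exact hz.tendsto_atBot.sup_sup hz.tendsto_atTop

theorem eq_add_intCast (hz : IsQuasiPeriodic T z)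
    (hstep : ∀ i : Fin T, z ((i : ℕ) + 1) = z (i : ℕ) + 1) (j : ℤ) : z j = z 0 + j := by
  have hperiodic : Function.Periodic (fun j : ℤ => z j - j) 1 := fun j => by
    obtain ⟨⟨i, k⟩, rfl⟩ := (labelEquiv T).symm.surjective j
    simp only [labelEquiv_symm_apply, add_comm _ ((i : ℕ) : ℤ), add_right_comm _ _ (1 : ℤ),
      hz.add_mul_period, hstep]
    push_cast
    ring
  have := hperiodic.int_mul j 0
  simp only [mul_one, zero_add, Int.cast_zero, sub_zero, Int.cast_id] at this
  linarith

end IsQuasiPeriodic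

/-- The increment across the increasing steps `G (· - z j)` when the step `j` of the point `x` is
matched with the step `j + n` of the point `x + h`. -/
def pairIncrement (G : ℝ → ℝ) (z : ℤ → ℝ) (h : ℝ) (n j : ℤ) (x : ℝ) : ℝ :=
  G (x + h - z (j + n)) - G (x - z j)

section PairIncrement

variable {T : ℕ} {ε : ℝ} {φ ψ G : ℝ → ℝ} {z : ℤ → ℝ}

theorem pairIncrement_eq_shift_sub (G : ℝ → ℝ) (z : ℤ → ℝ) (h : ℝ) (n j : ℤ) (x : ℝ) :
    pairIncrement G z h n j x = G (x - (z (j + n) - h)) - G (x - z j) := by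
  rw [pairIncrement, ← sub_add, sub_add_eq_add_sub]

theorem integral_pairIncrement (ψ G : ℝ → ℝ) (z : ℤ → ℝ) (h : ℝ) (n j : ℤ) :
    ∫ x, ψ (pairIncrement G z h n j x) = shiftCost ψ G (h - (z (j + n) - z j)) := by
  simp only [pairIncrement_eq_shift_sub, integral_shift_sub]
  congr 1
  ring

theorem IsTransition.continuous_pairIncrement (hG : IsTransition ε G) (z : ℤ → ℝ) (h : ℝ)
    (n j : ℤ) : Continuous (pairIncrement G z h n j) := by
  have := hG.continuous
  unfold pairIncrement
  fun_prop

theorem IsTransition.locallyFinite_pairIncrement [NeZero T] (hG : IsTransition ε G)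
    (hz : IsQuasiPeriodic T z) (h : ℝ) (n : ℤ) :
    LocallyFinite fun j => Function.support (pairIncrement G z h n j) := by
  obtain ⟨C, hC⟩ := hz.exists_abs_sub_le
  have hbound : ∀ j, |z (j + n) - h - z j| ≤ C + C + |n - h| := fun j => by
    calc |z (j + n) - h - z j|
      _ = |(z (j + n) - (j + n : ℤ)) - (z j - j) + (n - h)| := by push_cast; ring_nf
      _ ≤ C + C + |n - h| :=
        (abs_add_le _ _).trans (add_le_add_left ((abs_sub _ _).trans (add_le_add (hC _) (hC _))) _)
  simpa only [← pairIncrement_eq_shift_sub] using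
    hG.locallyFinite_support_shift_sub hz.tendsto_cofinite hbound

theorem IsQuasiPeriodic.pairIncrement_add_mul (hz : IsQuasiPeriodic T z) (G : ℝ → ℝ) (h : ℝ)
    (n j k : ℤ) (x : ℝ) :
    pairIncrement G z h n (j + k * T) x = pairIncrement G z h n j (x - k * T) := by
  rw [pairIncrement, pairIncrement, add_right_comm, hz.add_mul_period, hz.add_mul_period]
  ring_nf

theorem IsTransition.pairIncrement_same_sign (hG : IsTransition ε G)
    (hgap : ∀ j k, j < k → z j + 2 * ε ≤ z k) (h : ℝ) (n : ℤ) (x : ℝ) :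
    (∀ j, 0 ≤ pairIncrement G z h n j x) ∨ ∀ j, pairIncrement G z h n j x ≤ 0 := by
  have at_most_one_active : ∀ y j k, j < k → G (y - z j) < 1 → G (y - z k) = 0 := by
    intro y j k hjk hlt
    have hy : y - z j < ε := lt_of_not_ge fun hge => hlt.ne (hG.eq_one _ hge)
    exact hG.eq_zero _ (by linarith [hgap j k hjk])
  by_contra hcon
  push Not at hcon
  obtain ⟨⟨k, hk⟩, i, hi⟩ := hcon
  simp only [pairIncrement, sub_pos, sub_neg] at hk hi
  obtain hik | rfl | hki := lt_trichotomy i k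
  · have := at_most_one_active x i k hik (hi.trans_le (hG.le_one _))
    linarith [hG.nonneg (x + h - z (k + n))]
  · exact lt_asymm hk hi
  · have := at_most_one_active (x + h) (k + n) (i + n) (by lia) (hk.trans_le (hG.le_one _))
    linarith [hG.nonneg (x - z i)]

theorem IsTransition.subsingleton_support_pairIncrement_intCast (hG : IsTransition ε G) {h : ℝ}
    {n : ℤ} (hn : 2 * ε + |h - n| ≤ 1) (x : ℝ) :
    (Function.support fun j => pairIncrement G (fun j => (j : ℝ)) h n j x).Subsingleton := by
  have hle := le_abs_self (h - n)
  have hge := neg_abs_le (h - n)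
  have no_lt : ∀ j k : ℤ, pairIncrement G (fun j => (j : ℝ)) h n j x ≠ 0 →
      pairIncrement G (fun j => (j : ℝ)) h n k x ≠ 0 → ¬ j < k := by
    intro j k hj hk hjk
    have hjk' : (j : ℝ) + 1 ≤ k := by exact_mod_cast hjk
    simp only [pairIncrement, Int.cast_add] at hj hk
    have hjx : x - j < ε ∨ x + h - (j + n) < ε := by
      by_contra! hcon
      exact hj (by rw [hG.eq_one _ hcon.1, hG.eq_one _ hcon.2, sub_self])
    have hkx : -ε < x - k ∨ -ε < x + h - (k + n) := by
      by_contra! hcon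
      exact hk (by rw [hG.eq_zero _ hcon.1, hG.eq_zero _ hcon.2, sub_self])
    obtain hjx | hjx := hjx <;> obtain hkx | hkx := hkx <;> linarith [abs_nonneg (h - n)]
  intro j hj k hk
  exact le_antisymm (not_lt.1 (no_lt k j hk hj)) (not_lt.1 (no_lt j k hj hk))

theorem IsTransition.integral_tsum_pairIncrement [NeZero T] (hG : IsTransition ε G)
    (hz : IsQuasiPeriodic T z) (hψ : Continuous ψ) (h0 : ψ 0 = 0) (h : ℝ) (n : ℤ) :
    ∫ x in (0 : ℝ)..T, ∑' j, ψ (pairIncrement G z h n j x) =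
      ∑ i : Fin T, shiftCost ψ G (h - (z ((i : ℕ) + n) - z (i : ℕ))) := by
  have hT : (0 : ℝ) < T := by exact_mod_cast NeZero.pos T
  have hall := hasSum_intervalIntegral_of_locallyFinite
    (fun j => hψ.comp (hG.continuous_pairIncrement z h n j))
    ((hG.locallyFinite_pairIncrement hz h n).subset fun _ => Function.support_comp_subset h0 _)
    0 T
  have hfiber : ∀ i : Fin T, HasSum (fun k : ℤ => ∫ x in (0 : ℝ)..T,
      ψ (pairIncrement G z h n ((labelEquiv T).symm (i, k)) x))
      (shiftCost ψ G (h - (z ((i : ℕ) + n) - z (i : ℕ)))) := fun i => by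
    have := hasSum_intervalIntegral_comp_sub_mul
      (hG.integrable_shift_sub hψ h0 (z ((i : ℕ) + n) - h) (z (i : ℕ))) hT
    simp only [← pairIncrement_eq_shift_sub, integral_pairIncrement] at this
    simpa only [labelEquiv_symm_apply, add_comm _ ((i : ℕ) : ℤ), hz.pairIncrement_add_mul]
  exact (((labelEquiv T).symm.hasSum_iff.2 hall).prod_fiberwise hfiber).unique (hasSum_fintype _)

end PairIncrement

/-- `v` is a primitive of `1 - ∑ j, (d/dx) G (x - z j)`: it grows with slope `1` except for
downward steps of shape `G` at the points `z j`. -/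
def IsSmoothedDisplacement {ι : Type*} (G : ℝ → ℝ) (z : ι → ℝ) (v : ℝ → ℝ) : Prop :=
  ∀ x y, v y - v x = y - x - ∑' j, (G (y - z j) - G (x - z j))

namespace IsSmoothedDisplacement

variable {ι : Type*} {G v : ℝ → ℝ}

theorem comp_equiv {ι' : Type*} {z : ι → ℝ} (hv : IsSmoothedDisplacement G z v) (e : ι' ≃ ι) :
    IsSmoothedDisplacement G (z ∘ e) v := fun x y => by
  rw [hv x y, ← e.tsum_eq]
  rfl

theorem comp_add_right {z : ι → ℝ} (hv : IsSmoothedDisplacement G z v) (a : ℝ) :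
    IsSmoothedDisplacement G (fun j => z j - a) fun x => v (x + a) := fun x y => by
  simpa only [add_sub_add_right_eq_sub, sub_sub_eq_add_sub] using hv (x + a) (y + a)

theorem shift_sub_eq {T : ℕ} [NeZero T] {ε : ℝ} {z : ℤ → ℝ} (hv : IsSmoothedDisplacement G z v)
    (hG : IsTransition ε G) (hz : IsQuasiPeriodic T z) (h x : ℝ) (n : ℤ) :
    v (x + h) - v x = h - n - ∑' j, pairIncrement G z h n j x := by
  have hpair : Summable fun j => pairIncrement G z h n j x :=
    summable_of_hasFiniteSupport ((hG.locallyFinite_pairIncrement hz h n).point_finite x)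
  have htel : HasSum (fun j => G (x + h - z (j + n)) - G (x + h - z j)) (n * (0 - 1)) :=
    hasSum_int_add_sub (a := fun j => G (x + h - z j))
      ((hz.tendsto_atBot.eventually_le_atBot (x + h - ε)).mono fun _ hj =>
        hG.eq_one _ (by linarith))
      ((hz.tendsto_atTop.eventually_ge_atTop (x + h + ε)).mono fun _ hj =>
        hG.eq_zero _ (by linarith)) n
  have hsum : ∑' j, (G (x + h - z j) - G (x - z j)) =
      ∑' j, pairIncrement G z h n j x - n * (0 - 1) := by
    rw [← (hpair.hasSum.sub htel).tsum_eq]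
    exact tsum_congr fun j => by rw [pairIncrement]; ring
  rw [hv x (x + h), hsum]
  ring

end IsSmoothedDisplacement

/-- The cost `φ`, recentred at a mean increment `θ`, of a deviation by `t` below it. -/
def recentred (φ : ℝ → ℝ) (θ t : ℝ) : ℝ := φ (θ - t) - φ θ

theorem recentred_zero (φ : ℝ → ℝ) (θ : ℝ) : recentred φ θ 0 = 0 := by
  simp [recentred]

theorem convexOn_recentred {φ : ℝ → ℝ} (hφ : ConvexOn ℝ univ φ) (θ : ℝ) :
    ConvexOn ℝ univ (recentred φ θ) :=
  (hφ.comp_affineMap (AffineMap.const ℝ ℝ θ - AffineMap.id ℝ ℝ)).sub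
    (concaveOn_const (φ θ) convex_univ)

/-- The total cost `φ` over a period of length `T` of the increments of `v` at distance `h`. -/
noncomputable def incrementEnergy (T : ℕ) (φ v : ℝ → ℝ) (h : ℝ) : ℝ :=
  ∫ x in (0 : ℝ)..T, φ (v (x + h) - v x)

section IncrementEnergy

variable {T : ℕ} [NeZero T] {ε : ℝ} {φ G v : ℝ → ℝ} {z : ℤ → ℝ}

theorem IsTransition.continuous_tsum_comp_pairIncrement {ψ : ℝ → ℝ} (hG : IsTransition ε G)
    (hz : IsQuasiPeriodic T z) (hψ : Continuous ψ) (h0 : ψ 0 = 0) (h : ℝ) (n : ℤ) :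
    Continuous fun x => ∑' j, ψ (pairIncrement G z h n j x) :=
  continuous_tsum_of_locallyFinite (fun j => hψ.comp (hG.continuous_pairIncrement z h n j))
    ((hG.locallyFinite_pairIncrement hz h n).subset fun _ => Function.support_comp_subset h0 _)

theorem incrementEnergy_eq_add_integral (hv : IsSmoothedDisplacement G z v)
    (hG : IsTransition ε G) (hz : IsQuasiPeriodic T z) (hφ : ConvexOn ℝ univ φ) (h : ℝ) (n : ℤ) :
    incrementEnergy T φ v h = T * φ (h - n) +
      ∫ x in (0 : ℝ)..T, recentred φ (h - n) (∑' j, pairIncrement G z h n j x) := by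
  have hcont : Continuous fun x => recentred φ (h - n) (∑' j, pairIncrement G z h n j x) :=
    (continuous_of_convexOn_univ (convexOn_recentred hφ (h - n))).comp
      (hG.continuous_tsum_comp_pairIncrement hz continuous_id rfl h n)
  have hpt : ∀ x, φ (v (x + h) - v x) =
      φ (h - n) + recentred φ (h - n) (∑' j, pairIncrement G z h n j x) := fun x => by
    rw [hv.shift_sub_eq hG hz h x n, recentred]; ring
  simp only [incrementEnergy, hpt]
  rw [intervalIntegral.integral_add intervalIntegrable_const (hcont.intervalIntegrable _ _)]
  simp

theorem add_sum_shiftCost_le_incrementEnergy (hv : IsSmoothedDisplacement G z v)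
    (hG : IsTransition ε G) (hz : IsQuasiPeriodic T z) (hgap : ∀ j k, j < k → z j + 2 * ε ≤ z k)
    (hφ : ConvexOn ℝ univ φ) (h : ℝ) (n : ℤ) :
    T * φ (h - n) + ∑ i : Fin T,
      shiftCost (recentred φ (h - n)) G (h - (z ((i : ℕ) + n) - z (i : ℕ))) ≤
      incrementEnergy T φ v h := by
  have hψ := convexOn_recentred hφ (h - n)
  have hψc := continuous_of_convexOn_univ hψ
  have h0 := recentred_zero φ (h - n)
  rw [incrementEnergy_eq_add_integral hv hG hz hφ h n,
    ← hG.integral_tsum_pairIncrement hz hψc h0 h n]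
  refine add_le_add_right (intervalIntegral.integral_mono_on (Nat.cast_nonneg T)
    ((hG.continuous_tsum_comp_pairIncrement hz hψc h0 h n).intervalIntegrable _ _)
    ((hψc.comp (hG.continuous_tsum_comp_pairIncrement hz continuous_id rfl h n)).intervalIntegrable
      _ _)
    fun x _ => ?_) _
  exact tsum_map_le_map_tsum_of_same_sign hψ h0
    ((hG.locallyFinite_pairIncrement hz h n).point_finite x)
    (hG.pairIncrement_same_sign hgap h n x)

theorem mul_add_shiftCost_le_incrementEnergy (hv : IsSmoothedDisplacement G z v)
    (hG : IsTransition ε G) (hz : IsQuasiPeriodic T z) (hgap : ∀ j k, j < k → z j + 2 * ε ≤ z k)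
    (hφ : ConvexOn ℝ univ φ) (h : ℝ) (n : ℤ) :
    T * (φ (h - n) + shiftCost (recentred φ (h - n)) G (h - n)) ≤ incrementEnergy T φ v h := by
  have hmean : ∑ i : Fin T, (h - (z ((i : ℕ) + n) - z (i : ℕ))) =
      (Finset.univ : Finset (Fin T)).card * (h - n) := by
    rw [Finset.sum_sub_distrib, hz.sum_shift_sub]; simp; ring
  have hjensen := (hG.isWrightConvex_shiftCost (convexOn_recentred hφ (h - n))
    (recentred_zero φ _)).card_mul_le_sum Finset.univ _ hmean
  rw [Finset.card_fin] at hjensen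
  calc T * (φ (h - n) + shiftCost (recentred φ (h - n)) G (h - n))
    _ = T * φ (h - n) + T * shiftCost (recentred φ (h - n)) G (h - n) := mul_add _ _ _
    _ ≤ _ := add_le_add_right hjensen _
    _ ≤ incrementEnergy T φ v h := add_sum_shiftCost_le_incrementEnergy hv hG hz hgap hφ h n

theorem incrementEnergy_intCast_eq (hv : IsSmoothedDisplacement G (fun j : ℤ => (j : ℝ)) v)
    (hG : IsTransition ε G) (hφ : ConvexOn ℝ univ φ) {h : ℝ} {n : ℤ} (hn : 2 * ε + |h - n| ≤ 1) :
    incrementEnergy T φ v h = T * (φ (h - n) + shiftCost (recentred φ (h - n)) G (h - n)) := by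
  have hz := isQuasiPeriodic_intCast T
  have h0 := recentred_zero φ (h - n)
  rw [incrementEnergy_eq_add_integral hv hG hz hφ h n]
  simp only [map_tsum_eq_tsum_map_of_subsingleton h0
    (hG.subsingleton_support_pairIncrement_intCast hn _)]
  rw [hG.integral_tsum_pairIncrement hz
    (continuous_of_convexOn_univ (convexOn_recentred hφ (h - n))) h0 h n]
  simp [mul_add]

theorem eq_add_of_incrementEnergy_one_eq_zero (hv : IsSmoothedDisplacement G z v)
    (hG : IsTransition ε G) (hz : IsQuasiPeriodic T z) (hgap : ∀ j k, j < k → z j + 2 * ε ≤ z k)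
    (hφ : ConvexOn ℝ univ φ) (hnonneg : ∀ t, 0 ≤ φ t) (hzero : ∀ t, φ t = 0 ↔ t = 0)
    (henergy : incrementEnergy T φ v 1 = 0) (j : ℤ) : z j = z 0 + j := by
  have hψ : ∀ t, recentred φ 0 t = φ (-t) := fun t => by
    rw [recentred, zero_sub, (hzero 0).2 rfl, sub_zero]
  have hcost_nonneg : ∀ τ, 0 ≤ shiftCost (recentred φ 0) G τ := fun τ =>
    integral_nonneg fun x => (hψ _).symm ▸ hnonneg _
  have hsum := add_sum_shiftCost_le_incrementEnergy hv hG hz hgap hφ 1 1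
  rw [henergy, Int.cast_one, sub_self, (hzero 0).2 rfl, mul_zero, zero_add] at hsum
  have hcost := (Finset.sum_eq_zero_iff_of_nonneg fun i _ => hcost_nonneg _).1
    (hsum.antisymm (Finset.sum_nonneg fun i _ => hcost_nonneg _))
  have hstep : ∀ i : Fin T, z ((i : ℕ) + 1) = z (i : ℕ) + 1 := fun i => by
    have := hG.eq_zero_of_shiftCost_eq_zero
      (continuous_of_convexOn_univ (convexOn_recentred hφ 0))
      (fun t => (hψ t).symm ▸ hnonneg _) (fun t => by rw [hψ, hzero, neg_eq_zero])
      (hcost i (Finset.mem_univ i))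
    linarith
  exact hz.eq_add_intCast hstep j

end IncrementEnergy

theorem convexOn_abs_rpow {p : ℝ} (hp : 1 ≤ p) : ConvexOn ℝ univ fun t : ℝ => |t| ^ p := by
  have himage : (fun t : ℝ => ‖t‖) '' univ ⊆ Ici 0 := by
    rintro _ ⟨t, -, rfl⟩
    exact norm_nonneg t
  have hconvex : Convex ℝ ((fun t : ℝ => ‖t‖) '' univ) :=
    (isPreconnected_univ.image _ continuous_norm.continuousOn).ordConnected.convex
  exact ((convexOn_rpow hp).subset himage hconvex).comp convexOn_univ_norm
    ((Real.monotoneOn_rpow_Ici_of_exponent_nonneg (zero_le_one.trans hp)).mono himage)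

/-- The rescaled mollifier `ρ_ε`. -/
noncomputable def rescale (ρ : ℝ → ℝ) (ε x : ℝ) : ℝ := ε⁻¹ * ρ (x / ε)

/-- The primitive of `ρ_ε` vanishing to the left of its support, that is, the mollified Heaviside
function. -/
noncomputable def mollifiedStep (ρ : ℝ → ℝ) (ε x : ℝ) : ℝ := ∫ t in -ε..x, rescale ρ ε t

namespace IsMollifier

variable {ρ : ℝ → ℝ} {ε : ℝ}

theorem contDiff_rescale (hρ : IsMollifier ρ) (ε : ℝ) : ContDiff ℝ ∞ (rescale ρ ε) :=
  contDiff_const.mul (hρ.contDiff.comp (contDiff_id.div_const ε))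

theorem continuous_rescale (hρ : IsMollifier ρ) (ε : ℝ) : Continuous (rescale ρ ε) :=
  (hρ.contDiff_rescale ε).continuous

theorem support_rescale_subset (hρ : IsMollifier ρ) (hε : 0 < ε) :
    Function.support (rescale ρ ε) ⊆ Ioo (-ε) ε := fun x hx => by
  have hx' := hρ.support_subset (right_ne_zero_of_mul hx : ρ (x / ε) ≠ 0)
  rwa [mem_Ioo, lt_div_iff₀ hε, div_lt_iff₀ hε, neg_one_mul, one_mul] at hx'

theorem rescale_eq_zero (hρ : IsMollifier ρ) (hε : 0 < ε) {x : ℝ} (hx : x ∉ Ioo (-ε) ε) :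
    rescale ρ ε x = 0 :=
  Function.notMem_support.1 fun h => hx (hρ.support_rescale_subset hε h)

theorem hasCompactSupport_rescale (hρ : IsMollifier ρ) (hε : 0 < ε) :
    HasCompactSupport (rescale ρ ε) :=
  HasCompactSupport.of_support_subset_isCompact isCompact_Icc
    ((hρ.support_rescale_subset hε).trans Ioo_subset_Icc_self)

theorem integral_rescale (hρ : IsMollifier ρ) (hε : 0 < ε) : ∫ x, rescale ρ ε x = 1 := by
  simp only [rescale]
  rw [integral_const_mul, Measure.integral_comp_div, hρ.integral_eq_one, abs_of_pos hε,
    smul_eq_mul, mul_one, inv_mul_cancel₀ hε.ne']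

theorem mollifiedStep_sub (hρ : IsMollifier ρ) (ε x y : ℝ) :
    mollifiedStep ρ ε y - mollifiedStep ρ ε x = ∫ t in x..y, rescale ρ ε t :=
  intervalIntegral.integral_interval_sub_left
    ((hρ.continuous_rescale ε).intervalIntegrable _ _)
    ((hρ.continuous_rescale ε).intervalIntegrable _ _)

theorem isTransition_mollifiedStep (hρ : IsMollifier ρ) (hε : 0 < ε) :
    IsTransition ε (mollifiedStep ρ ε) where
  continuous := intervalIntegral.continuous_primitive
    (fun _ _ => (hρ.continuous_rescale ε).intervalIntegrable _ _) _
  monotone x y hxy := by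
    rw [← sub_nonneg, hρ.mollifiedStep_sub]
    exact intervalIntegral.integral_nonneg hxy fun t _ =>
      mul_nonneg (inv_nonneg.2 hε.le) (hρ.nonneg _)
  eq_zero x hx := by
    refine intervalIntegral.integral_zero_ae (Eventually.of_forall fun t ht => ?_)
    rw [uIoc_of_ge hx] at ht
    exact hρ.rescale_eq_zero hε fun h => h.1.not_ge ht.2
  eq_one x hx := by
    rw [mollifiedStep, intervalIntegral.integral_eq_integral_of_support_subset
      ((hρ.support_rescale_subset hε).trans fun t ht => ⟨ht.1, ht.2.le.trans hx⟩),
      hρ.integral_rescale hε]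

end IsMollifier

namespace Configuration

variable {T : ℕ}

section Enumeration

variable [NeZero T]

/-- The points of a configuration listed in increasing order. -/
def enum (X : Configuration T) (j : ℤ) : ℝ := X.point (labelEquiv T j)

theorem enum_labelEquiv_symm (X : Configuration T) (b : Fin T × ℤ) :
    X.enum ((labelEquiv T).symm b) = X.point b := by
  rw [enum, Equiv.apply_symm_apply]

theorem isQuasiPeriodic_enum (X : Configuration T) : IsQuasiPeriodic T X.enum := fun j => by
  obtain ⟨⟨i, k⟩, rfl⟩ := (labelEquiv T).symm.surjective j
  have hshift : (labelEquiv T).symm (i, k) + T = (labelEquiv T).symm (i, k + 1) := by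
    simp only [labelEquiv_symm_apply]; ring
  rw [hshift, enum_labelEquiv_symm, enum_labelEquiv_symm, point, point]
  push_cast
  ring

theorem monotone_enum (X : Configuration T) : Monotone X.enum := by
  refine monotone_int_of_le_succ fun j => ?_
  obtain ⟨⟨i, k⟩, rfl⟩ := (labelEquiv T).symm.surjective j
  rw [enum_labelEquiv_symm]
  by_cases hi : (i : ℕ) + 1 < T
  · have hnext : (labelEquiv T).symm (i, k) + 1 = (labelEquiv T).symm (⟨i + 1, hi⟩, k) := by
      simp only [labelEquiv_symm_apply]; push_cast; ring
    rw [hnext, enum_labelEquiv_symm]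
    exact add_le_add_left (X.mono (Fin.le_def.2 (Nat.le_succ _))) _
  · have hlast : ((i : ℕ) : ℤ) + 1 = T := by exact_mod_cast (by lia : (i : ℕ) + 1 = T)
    have hnext : (labelEquiv T).symm (i, k) + 1 = (labelEquiv T).symm (0, k + 1) := by
      simp only [labelEquiv_symm_apply, Fin.val_zero, Nat.cast_zero, ← hlast]; ring
    rw [hnext, enum_labelEquiv_symm, point, point]
    push_cast
    linarith [(X.mem i).2, (X.mem 0).1]

theorem enum_add_le_of_mem_regular {X : Configuration T} {l : ℝ} (hX : X ∈ regular T l) {j k : ℤ}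
    (hjk : j < k) : X.enum j + l ≤ X.enum k := by
  have hbdd : BddBelow {r : ℝ | ∃ a b, a ≠ b ∧ r = |X.point a - X.point b|} :=
    ⟨0, by rintro _ ⟨a, b, -, rfl⟩; exact abs_nonneg _⟩
  have hdist : l ≤ |X.enum k - X.enum j| :=
    le_trans hX (csInf_le hbdd ⟨_, _, (labelEquiv T).injective.ne hjk.ne', rfl⟩)
  rw [abs_of_nonneg (sub_nonneg.2 (X.monotone_enum hjk.le))] at hdist
  linarith

theorem point_equispaced (b : Fin T × ℤ) :
    (equispaced T).point b = ((labelEquiv T).symm b : ℤ) := by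
  simp only [point, equispaced, labelEquiv_symm_apply]
  push_cast
  ring

theorem enum_equispaced (j : ℤ) : (equispaced T).enum j = j := by
  rw [enum, point_equispaced, Equiv.symm_apply_apply]

theorem equispaced_mem_regular {l : ℝ} (hl : l ≤ 1) : equispaced T ∈ regular T l := by
  refine hl.trans (le_csInf ⟨_, (0, 0), (0, 1), by simp, rfl⟩ ?_)
  rintro _ ⟨a, b, hab, rfl⟩
  rw [point_equispaced, point_equispaced]
  exact_mod_cast Int.one_le_abs (sub_ne_zero.2 ((labelEquiv T).symm.injective.ne hab))

theorem isTranslate_equispaced_of_enum_eq {X : Configuration T}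
    (hX : ∀ j : ℤ, X.enum j = X.enum 0 + j) : X.IsTranslate (equispaced T) :=
  ⟨X.enum 0, Equiv.refl _, fun b => by
    rw [Equiv.refl_apply, ← enum_labelEquiv_symm, hX, point_equispaced, add_comm]⟩

theorem tendsto_point_cofinite (X : Configuration T) :
    Tendsto X.point cofinite (cocompact ℝ) := by
  simpa only [Function.comp_def, enum_labelEquiv_symm] using
    X.isQuasiPeriodic_enum.tendsto_cofinite.comp (labelEquiv T).symm.injective.tendsto_cofinite

end Enumeration

section Mollify

variable {ρ : ℝ → ℝ} {ε : ℝ}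

theorem isDisplacement_displacement (X : Configuration T) : X.IsDisplacement X.displacement :=
  Classical.choose_spec X.exists_isDisplacement

theorem contDiff_mollify (X : Configuration T) (hρ : IsMollifier ρ) (hε : 0 < ε) :
    ContDiff ℝ 1 (mollify ρ ε X.displacement) :=
  (hρ.hasCompactSupport_rescale hε).contDiff_convolution_right (ContinuousLinearMap.mul ℝ ℝ)
    X.isDisplacement_displacement.locallyIntegrable ((hρ.contDiff_rescale ε).of_le (by simp))

theorem periodic_mollify (X : Configuration T) (ρ : ℝ → ℝ) (ε : ℝ) :
    Function.Periodic (mollify ρ ε X.displacement) T := fun x => by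
  change ∫ t, X.displacement t * rescale ρ ε (x + T - t) =
    ∫ t, X.displacement t * rescale ρ ε (x - t)
  rw [← integral_add_right_eq_self _ (T : ℝ)]
  refine integral_congr_ae ?_
  filter_upwards [X.isDisplacement_displacement.periodic] with t ht
  rw [ht, add_sub_add_right_eq_sub]

theorem hasDerivAt_mollify (X : Configuration T) (hρ : IsMollifier ρ) (hε : 0 < ε) (y : ℝ) :
    HasDerivAt (mollify ρ ε X.displacement)
      (1 - ∑ i, ∑' k : ℤ, rescale ρ ε (y - X.point (i, k))) y := by
  have hu := X.isDisplacement_displacement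
  have hsmooth := hρ.contDiff_rescale ε
  have hcompact := hρ.hasCompactSupport_rescale hε
  have hweak := hu.weakDeriv (fun t => rescale ρ ε (y - t))
    (hsmooth.comp (contDiff_const.sub contDiff_id))
    (hcompact.comp_homeomorph (Homeomorph.subLeft y))
  rw [integral_sub_left_eq_self (rescale ρ ε), hρ.integral_rescale hε] at hweak
  have hconv : convolution X.displacement (deriv (rescale ρ ε))
      (ContinuousLinearMap.mul ℝ ℝ) volume y =
      -∫ t, X.displacement t * deriv (fun t => rescale ρ ε (y - t)) t := by
    simp only [deriv_comp_const_sub, convolution, ContinuousLinearMap.mul_apply', mul_neg,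
      integral_neg, neg_neg]
  have hderiv := hcompact.hasDerivAt_convolution_right (ContinuousLinearMap.mul ℝ ℝ)
    hu.locallyIntegrable (hsmooth.of_le (by simp)) y
  rwa [hconv, hweak] at hderiv

theorem exists_lipschitzWith_mollify [NeZero T] (X : Configuration T) (hρ : IsMollifier ρ)
    (hε : 0 < ε) : ∃ L, LipschitzWith L (mollify ρ ε X.displacement) := by
  have hsmooth := X.contDiff_mollify hρ hε
  have hperiodic : Function.Periodic (deriv (mollify ρ ε X.displacement)) T := fun x => by
    rw [← deriv_comp_add_const, funext (X.periodic_mollify ρ ε)]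
  obtain ⟨L, hL⟩ := (hperiodic.isBounded_of_continuous (Nat.cast_ne_zero.2 (NeZero.ne T))
    (hsmooth.continuous_deriv le_rfl)).exists_norm_le
  exact ⟨L.toNNReal, lipschitzWith_of_nnnorm_deriv_le (hsmooth.differentiable one_ne_zero) fun x =>
    NNReal.le_toNNReal_of_coe_le (hL _ (mem_range_self x))⟩

variable [NeZero T]

theorem locallyFinite_support_rescale_sub_point (X : Configuration T) (hρ : IsMollifier ρ)
    (hε : 0 < ε) : LocallyFinite fun b => Function.support fun t => rescale ρ ε (t - X.point b) :=
  locallyFinite_of_tendsto_cocompact (R := ε) X.tendsto_point_cofinite fun b t ht => by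
    rw [Metric.mem_closedBall, Real.dist_eq]
    exact (abs_lt.2 (hρ.support_rescale_subset hε ht)).le

theorem isSmoothedDisplacement_mollify (X : Configuration T) (hρ : IsMollifier ρ) (hε : 0 < ε) :
    IsSmoothedDisplacement (mollifiedStep ρ ε) X.point (mollify ρ ε X.displacement) := by
  intro x y
  have hcont := hρ.continuous_rescale ε
  have hfinite := X.locallyFinite_support_rescale_sub_point hρ hε
  have hkernel : ∀ b, Continuous fun t => rescale ρ ε (t - X.point b) := fun b => by fun_prop
  have hdensity := continuous_tsum_of_locallyFinite hkernel hfinite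
  have hderiv : ∀ t, HasDerivAt (mollify ρ ε X.displacement)
      (1 - ∑' b, rescale ρ ε (t - X.point b)) t := fun t => by
    have hsum : Summable fun b => rescale ρ ε (t - X.point b) :=
      summable_of_hasFiniteSupport (hfinite.point_finite t)
    rw [hsum.tsum_prod, tsum_fintype]
    exact X.hasDerivAt_mollify hρ hε t
  rw [← intervalIntegral.integral_eq_sub_of_hasDerivAt (fun t _ => hderiv t)
    ((continuous_const.sub hdensity).intervalIntegrable _ _), intervalIntegral.integral_sub
    intervalIntegrable_const (hdensity.intervalIntegrable _ _), intervalIntegral.integral_const,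
    smul_eq_mul, mul_one,
    ← (hasSum_intervalIntegral_of_locallyFinite hkernel hfinite x y).tsum_eq]
  simp only [hρ.mollifiedStep_sub, intervalIntegral.integral_comp_sub_right]

theorem isSmoothedDisplacement_mollify_enum (X : Configuration T) (hρ : IsMollifier ρ)
    (hε : 0 < ε) :
    IsSmoothedDisplacement (mollifiedStep ρ ε) X.enum (mollify ρ ε X.displacement) :=
  (X.isSmoothedDisplacement_mollify hρ hε).comp_equiv (labelEquiv T)

end Mollify

end Configuration

section Energy

variable {T : ℕ} {φ v : ℝ → ℝ}

theorem incrementEnergy_nonneg (T : ℕ) (hφ : ∀ t, 0 ≤ φ t) (v : ℝ → ℝ) (h : ℝ) :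
    0 ≤ incrementEnergy T φ v h :=
  intervalIntegral.integral_nonneg (Nat.cast_nonneg T) fun _ _ => hφ _

theorem continuous_incrementEnergy (T : ℕ) (hφ : Continuous φ) (hv : Continuous v) :
    Continuous (incrementEnergy T φ v) :=
  intervalIntegral.continuous_parametric_intervalIntegral_of_continuous
    (f := fun h x => φ (v (x + h) - v x)) (by fun_prop) continuous_const

theorem incrementEnergy_le {B h : ℝ} (hφ : Continuous φ) (hv : Continuous v)
    (hB : ∀ x, φ (v (x + h) - v x) ≤ B) : incrementEnergy T φ v h ≤ T * B := by
  have hconst : (T : ℝ) * B = ∫ _ in (0 : ℝ)..T, B := by simp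
  rw [hconst]
  exact intervalIntegral.integral_mono_on (Nat.cast_nonneg T)
    (Continuous.intervalIntegrable (by fun_prop) _ _) intervalIntegrable_const fun x _ => hB x

theorem incrementEnergy_congr {w : ℝ → ℝ} (hvw : ∀ x y, v y - v x = w y - w x) :
    incrementEnergy T φ v = incrementEnergy T φ w := by
  funext h
  simp only [incrementEnergy, hvw]

theorem incrementEnergy_comp_add_right (hv : Function.Periodic v T) (φ : ℝ → ℝ) (a : ℝ) :
    incrementEnergy T φ (fun x => v (x + a)) = incrementEnergy T φ v := by
  funext h
  have hperiodic : Function.Periodic (fun x => φ (v (x + h) - v x)) T := fun x => by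
    simp only [add_right_comm x (T : ℝ) h, hv _]
  have hshift := hperiodic.intervalIntegral_add_eq a 0
  rw [zero_add, add_comm a] at hshift
  simpa only [incrementEnergy, add_right_comm _ h a, zero_add, hshift] using
    intervalIntegral.integral_comp_add_right (a := 0) (b := T)
      (fun x => φ (v (x + h) - v x)) a

theorem continuous_abs_rpow {p : ℝ} (hp : 0 ≤ p) : Continuous fun t : ℝ => |t| ^ p :=
  continuous_abs.rpow_const fun _ => Or.inr hp

theorem gagliardoEnergy_eq_lintegral_incrementEnergy {p : ℝ} (s : ℝ) (hv : Continuous v)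
    (hp : 0 ≤ p) :
    gagliardoEnergy T s p v = ∫⁻ h, ENNReal.ofReal
      (incrementEnergy T (fun t => |t| ^ p) v h / |h| ^ (1 + s * p)) := by
  have hshift : ∀ x, ∫⁻ y, ENNReal.ofReal (|v x - v y| ^ p / |x - y| ^ (1 + s * p)) =
      ∫⁻ h, ENNReal.ofReal (|v (x + h) - v x| ^ p / |h| ^ (1 + s * p)) := fun x => by
    rw [← lintegral_add_left_eq_self _ x]
    simp only [sub_add_cancel_left, abs_neg, abs_sub_comm (v x)]
  have hmeas : Measurable fun q : ℝ × ℝ =>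
      ENNReal.ofReal (|v (q.1 + q.2) - v q.1| ^ p / |q.2| ^ (1 + s * p)) := by
    have := hv.measurable
    fun_prop
  simp only [gagliardoEnergy, hshift]
  rw [lintegral_lintegral_swap hmeas.aemeasurable]
  refine lintegral_congr fun h => ?_
  have hcont : Continuous fun x => |v (x + h) - v x| ^ p / |h| ^ (1 + s * p) :=
    ((continuous_abs_rpow hp).comp (by fun_prop : Continuous fun x => v (x + h) - v x)).div_const _
  rw [← ofReal_integral_eq_lintegral_ofReal hcont.integrableOn_Icc
    (Eventually.of_forall fun x => by positivity), integral_Icc_eq_integral_Ioc,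
    ← intervalIntegral.integral_of_le (Nat.cast_nonneg T), intervalIntegral.integral_div,
    incrementEnergy]

theorem integrable_piecewise_abs_rpow {a b : ℝ} (ha : -1 < a) (hb : b < -1) :
    Integrable fun h : ℝ => if |h| ≤ 1 then |h| ^ a else |h| ^ b := by
  have hradial : IntegrableOn (fun y : ℝ => if y ≤ 1 then y ^ a else y ^ b) (Ioi 0) := by
    have hnear : IntegrableOn (fun y : ℝ => y ^ a) (Ioc 0 1) :=
      (intervalIntegrable_iff_integrableOn_Ioc_of_le zero_le_one).1
        (intervalIntegral.intervalIntegrable_rpow' ha)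
    have hfar : IntegrableOn (fun y : ℝ => y ^ b) (Ioi 1) :=
      integrableOn_Ioi_rpow_of_lt hb one_pos
    rw [← Ioc_union_Ioi_eq_Ioi zero_le_one]
    exact (hnear.congr_fun (fun y hy => (if_pos hy.2).symm) measurableSet_Ioc).union
      (hfar.congr_fun (fun y hy => (if_neg (not_le.2 hy)).symm) measurableSet_Ioi)
  simpa using (integrable_fun_norm_addHaar (volume : Measure ℝ)).2 (by simpa using hradial)

theorem incrementEnergy_abs_rpow_le_of_lipschitzWith {p : ℝ} {L : NNReal}
    (hv : LipschitzWith L v) (hp : 0 ≤ p) (h : ℝ) :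
    incrementEnergy T (fun t => |t| ^ p) v h ≤ T * L ^ p * |h| ^ p := by
  rw [mul_assoc, ← Real.mul_rpow L.coe_nonneg (abs_nonneg h)]
  exact incrementEnergy_le (continuous_abs_rpow hp) hv.continuous fun x =>
    Real.rpow_le_rpow (abs_nonneg _) (by simpa [Real.dist_eq] using hv.dist_le_mul (x + h) x) hp

theorem incrementEnergy_abs_rpow_le_of_abs_le {p M : ℝ} (hv : Continuous v)
    (hM : ∀ x, |v x| ≤ M) (hp : 0 ≤ p) (h : ℝ) :
    incrementEnergy T (fun t => |t| ^ p) v h ≤ T * (2 * M) ^ p :=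
  incrementEnergy_le (continuous_abs_rpow hp) hv fun x =>
    Real.rpow_le_rpow (abs_nonneg _)
      ((abs_sub _ _).trans (by linarith [hM (x + h), hM x])) hp

theorem gagliardoEnergy_ne_top [NeZero T] {s p : ℝ} {L : NNReal} (hv : LipschitzWith L v)
    (hperiodic : Function.Periodic v T) (hp : 0 < p) (hs0 : 0 < s) (hs1 : s < 1) :
    gagliardoEnergy T s p v ≠ ⊤ := by
  have hcont := hv.continuous
  obtain ⟨M, hM⟩ := (hperiodic.isBounded_of_continuous (Nat.cast_ne_zero.2 (NeZero.ne T))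
    hcont).exists_norm_le
  have hbound : ∀ x, |v x| ≤ M := fun x => hM _ (mem_range_self x)
  have hM0 : 0 ≤ M := (abs_nonneg _).trans (hbound 0)
  set C : ℝ := T * L ^ p + T * (2 * M) ^ p
  have hnear : ∀ h, incrementEnergy T (fun t => |t| ^ p) v h ≤ C * |h| ^ p := fun h =>
    (incrementEnergy_abs_rpow_le_of_lipschitzWith hv hp.le h).trans
      (by gcongr; exact le_add_of_nonneg_right (by positivity))
  have hfar : ∀ h, incrementEnergy T (fun t => |t| ^ p) v h ≤ C := fun h =>
    (incrementEnergy_abs_rpow_le_of_abs_le hcont hbound hp.le h).trans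
      (le_add_of_nonneg_left (by positivity))
  have hint := (integrable_piecewise_abs_rpow (a := p - (1 + s * p)) (b := -(1 + s * p))
    (by nlinarith) (by linarith [mul_pos hs0 hp])).const_mul C
  rw [gagliardoEnergy_eq_lintegral_incrementEnergy s hcont hp.le]
  refine ((lintegral_mono_ae ?_).trans_lt hint.lintegral_lt_top).ne
  filter_upwards [compl_mem_ae_iff.2 (measure_singleton (0 : ℝ))] with h hh
  have hpos : 0 < |h| := abs_pos.2 hh
  refine ENNReal.ofReal_le_ofReal ((div_le_iff₀ (by positivity)).2 ?_)
  split_ifs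
  · rw [mul_assoc, ← Real.rpow_add hpos, sub_add_cancel]
    exact hnear h
  · rw [mul_assoc, ← Real.rpow_add hpos, neg_add_cancel, Real.rpow_zero, mul_one]
    exact hfar h

theorem gagliardoEnergy_mono {p : ℝ} {w : ℝ → ℝ} (s : ℝ) (hp : 0 ≤ p) (hv : Continuous v)
    (hw : Continuous w) (hvw : ∀ h,
      incrementEnergy T (fun t => |t| ^ p) v h ≤ incrementEnergy T (fun t => |t| ^ p) w h) :
    gagliardoEnergy T s p v ≤ gagliardoEnergy T s p w := by
  rw [gagliardoEnergy_eq_lintegral_incrementEnergy s hv hp,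
    gagliardoEnergy_eq_lintegral_incrementEnergy s hw hp]
  gcongr with h
  exact hvw h

theorem incrementEnergy_eq_of_gagliardoEnergy_le {s p : ℝ} {w : ℝ → ℝ} (hp : 0 ≤ p)
    (hv : Continuous v) (hw : Continuous w)
    (hvw : ∀ h,
      incrementEnergy T (fun t => |t| ^ p) v h ≤ incrementEnergy T (fun t => |t| ^ p) w h)
    (hfinite : gagliardoEnergy T s p v ≠ ⊤)
    (hle : gagliardoEnergy T s p w ≤ gagliardoEnergy T s p v) :
    incrementEnergy T (fun t => |t| ^ p) v = incrementEnergy T (fun t => |t| ^ p) w := by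
  have hcont := fun {u : ℝ → ℝ} => continuous_incrementEnergy T (v := u) (continuous_abs_rpow hp)
  have hnonneg : ∀ (u : ℝ → ℝ) h,
      0 ≤ incrementEnergy T (fun t => |t| ^ p) u h / |h| ^ (1 + s * p) := fun u h =>
    div_nonneg (incrementEnergy_nonneg T (fun t => by positivity) u h) (by positivity)
  have hmeas : Measurable fun h =>
      ENNReal.ofReal (incrementEnergy T (fun t => |t| ^ p) w h / |h| ^ (1 + s * p)) := by
    have := (hcont hw).measurable
    fun_prop
  rw [gagliardoEnergy_eq_lintegral_incrementEnergy s hv hp] at hle hfinite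
  rw [gagliardoEnergy_eq_lintegral_incrementEnergy s hw hp] at hle
  have hae := ae_eq_of_ae_le_of_lintegral_le (Eventually.of_forall fun h =>
    ENNReal.ofReal_le_ofReal (div_le_div_of_nonneg_right (hvw h) (by positivity)))
    hfinite hmeas.aemeasurable hle
  refine (Continuous.ae_eq_iff_eq volume (hcont hv) (hcont hw)).1 ?_
  filter_upwards [hae, compl_mem_ae_iff.2 (measure_singleton (0 : ℝ))] with h hh h0
  have hpos : 0 < |h| := abs_pos.2 h0
  rw [ENNReal.ofReal_eq_ofReal_iff (hnonneg v h) (hnonneg w h)] at hh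
  exact (div_left_inj' (by positivity)).1 hh

end Energy

namespace Configuration

variable {T : ℕ} [NeZero T] {ρ : ℝ → ℝ} {ε s p l : ℝ} {X Y : Configuration T}

theorem IsTranslate.incrementEnergy_eq (hXY : X.IsTranslate Y) (hρ : IsMollifier ρ) (hε : 0 < ε)
    (φ : ℝ → ℝ) :
    incrementEnergy T φ (mollify ρ ε X.displacement) =
      incrementEnergy T φ (mollify ρ ε Y.displacement) := by
  obtain ⟨a, e, he⟩ := hXY
  have hX := ((X.isSmoothedDisplacement_mollify hρ hε).comp_equiv e).comp_add_right a
  simp only [Function.comp_apply, he, add_sub_cancel_right] at hX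
  rw [← incrementEnergy_comp_add_right (X.periodic_mollify ρ ε) φ a]
  exact incrementEnergy_congr fun x y =>
    (hX x y).trans (Y.isSmoothedDisplacement_mollify hρ hε x y).symm

theorem IsTranslate.mollifiedEnergy_eq (hXY : X.IsTranslate Y) (s : ℝ) (hρ : IsMollifier ρ)
    (hε : 0 < ε) (hp : 0 ≤ p) : mollifiedEnergy s p ρ ε X = mollifiedEnergy s p ρ ε Y := by
  simp only [mollifiedEnergy, hXY.incrementEnergy_eq hρ hε,
    gagliardoEnergy_eq_lintegral_incrementEnergy s (contDiff_mollify _ hρ hε).continuous hp]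

theorem incrementEnergy_equispaced_le (hρ : IsMollifier ρ) (hε : 0 < ε) (hε1 : 4 * ε ≤ 1)
    (hl : 2 * ε ≤ l) (hX : X ∈ regular T l) {φ : ℝ → ℝ} (hφ : ConvexOn ℝ univ φ) (h : ℝ) :
    incrementEnergy T φ (mollify ρ ε (equispaced T).displacement) h ≤
      incrementEnergy T φ (mollify ρ ε X.displacement) h := by
  have hG := hρ.isTransition_mollifiedStep hε
  have heq := (equispaced T).isSmoothedDisplacement_mollify_enum hρ hε
  rw [funext enum_equispaced] at heq
  rw [incrementEnergy_intCast_eq heq hG hφ (n := round h) (by linarith [abs_sub_round h])]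
  exact mul_add_shiftCost_le_incrementEnergy (X.isSmoothedDisplacement_mollify_enum hρ hε) hG
    X.isQuasiPeriodic_enum (fun j k hjk => by linarith [enum_add_le_of_mem_regular hX hjk]) hφ h _

theorem isMinOn_equispaced (s : ℝ) (hρ : IsMollifier ρ) (hε : 0 < ε) (hε1 : 4 * ε ≤ 1)
    (hl : 2 * ε ≤ l) (hp : 1 ≤ p) :
    IsMinOn (mollifiedEnergy s p ρ ε) (regular T l) (equispaced T) :=
  isMinOn_iff.2 fun X hX => gagliardoEnergy_mono s (zero_le_one.trans hp)
    (contDiff_mollify _ hρ hε).continuous (X.contDiff_mollify hρ hε).continuous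
    (incrementEnergy_equispaced_le hρ hε hε1 hl hX (convexOn_abs_rpow hp))

theorem incrementEnergy_equispaced_one (hρ : IsMollifier ρ) (hε : 0 < ε) (hε1 : 2 * ε ≤ 1)
    {φ : ℝ → ℝ} (hφ : ConvexOn ℝ univ φ) (h0 : φ 0 = 0) :
    incrementEnergy T φ (mollify ρ ε (equispaced T).displacement) 1 = 0 := by
  have heq := (equispaced T).isSmoothedDisplacement_mollify_enum hρ hε
  rw [funext enum_equispaced] at heq
  rw [incrementEnergy_intCast_eq heq (hρ.isTransition_mollifiedStep hε) hφ (n := 1) (by simpa)]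
  simp [shiftCost, recentred, h0]

theorem incrementEnergy_eq_of_mollifiedEnergy_le (hρ : IsMollifier ρ) (hε : 0 < ε)
    (hε1 : 4 * ε ≤ 1) (hl : 2 * ε ≤ l) (hp : 1 ≤ p) (hs0 : 0 < s) (hs1 : s < 1)
    (hX : X ∈ regular T l)
    (hle : mollifiedEnergy s p ρ ε X ≤ mollifiedEnergy s p ρ ε (equispaced T)) :
    incrementEnergy T (fun t => |t| ^ p) (mollify ρ ε (equispaced T).displacement) =
      incrementEnergy T (fun t => |t| ^ p) (mollify ρ ε X.displacement) := by
  obtain ⟨L, hL⟩ := (equispaced T).exists_lipschitzWith_mollify hρ hε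
  exact incrementEnergy_eq_of_gagliardoEnergy_le (zero_le_one.trans hp) hL.continuous
    (X.contDiff_mollify hρ hε).continuous
    (incrementEnergy_equispaced_le hρ hε hε1 hl hX (convexOn_abs_rpow hp))
    (gagliardoEnergy_ne_top hL ((equispaced T).periodic_mollify ρ ε)
      (zero_lt_one.trans_le hp) hs0 hs1) hle

theorem isTranslate_equispaced_of_mollifiedEnergy_le (hρ : IsMollifier ρ) (hε : 0 < ε)
    (hε1 : 4 * ε ≤ 1) (hl : 2 * ε ≤ l) (hp : 1 ≤ p) (hs0 : 0 < s) (hs1 : s < 1)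
    (hX : X ∈ regular T l)
    (hle : mollifiedEnergy s p ρ ε X ≤ mollifiedEnergy s p ρ ε (equispaced T)) :
    X.IsTranslate (equispaced T) := by
  have hp0 : p ≠ 0 := by linarith
  have hφ := convexOn_abs_rpow hp
  have hzero : ∀ t : ℝ, |t| ^ p = 0 ↔ t = 0 := fun t => by
    rw [Real.rpow_eq_zero (abs_nonneg t) hp0, abs_eq_zero]
  have henergy := congrFun
    (incrementEnergy_eq_of_mollifiedEnergy_le hρ hε hε1 hl hp hs0 hs1 hX hle) 1
  rw [incrementEnergy_equispaced_one hρ hε (by linarith) hφ ((hzero 0).2 rfl)] at henergy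
  exact isTranslate_equispaced_of_enum_eq <| eq_add_of_incrementEnergy_one_eq_zero
    (X.isSmoothedDisplacement_mollify_enum hρ hε) (hρ.isTransition_mollifiedStep hε)
    X.isQuasiPeriodic_enum (fun j k hjk => by linarith [enum_add_le_of_mem_regular hX hjk])
    hφ (fun t => by positivity) hzero henergy.symm

end Configuration

open Configuration in
theorem mainTheorem4_general (T : ℕ) [NeZero T] {p s ε l : ℝ} (hp : 1 ≤ p) (hs0 : 0 < s)
    (hs1 : s < 1) (hε : 0 < ε) (hε1 : 4 * ε ≤ 1) (hl : 2 * ε ≤ l) (hl1 : l ≤ 1)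
    {ρ : ℝ → ℝ} (hρ : IsMollifier ρ) :
    equispaced T ∈ regular T l ∧
    IsMinOn (mollifiedEnergy s p ρ ε) (regular T l) (equispaced T) ∧
    ∀ X ∈ regular T l,
      (IsMinOn (mollifiedEnergy s p ρ ε) (regular T l) X ↔ X.IsTranslate (equispaced T)) := by
  have hmem := equispaced_mem_regular (T := T) hl1
  have hmin := isMinOn_equispaced (T := T) s hρ hε hε1 hl hp
  refine ⟨hmem, hmin, fun X hX => ⟨fun hXmin => ?_, fun htrans => isMinOn_iff.2 fun Y hY => ?_⟩⟩
  · exact isTranslate_equispaced_of_mollifiedEnergy_le hρ hε hε1 hl hp hs0 hs1 hX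
      (isMinOn_iff.1 hXmin _ hmem)
  · rw [htrans.mollifiedEnergy_eq s hρ hε (zero_le_one.trans hp)]
    exact isMinOn_iff.1 hmin Y hY

theorem mainTheorem4 (T : ℕ) (hT : 0 < T) (p s ε : ℝ) (hp : 1 ≤ p) (hs0 : 0 < s) (hs1 : s < 1)
    (hsp : 1 ≤ s * p) (hε : 0 < ε) (hε1 : 4 * ε ≤ 1) (ρ : ℝ → ℝ) (hρ : IsMollifier ρ) :
    Configuration.equispaced T ∈ Configuration.regular T (4 * ε) ∧
    IsMinOn (Configuration.mollifiedEnergy s p ρ ε) (Configuration.regular T (4 * ε))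
      (Configuration.equispaced T) ∧
    ∀ X ∈ Configuration.regular T (4 * ε),
      (IsMinOn (Configuration.mollifiedEnergy s p ρ ε) (Configuration.regular T (4 * ε)) X ↔
        X.IsTranslate (Configuration.equispaced T)) := by
  have : NeZero T := ⟨hT.ne'⟩
  exact mainTheorem4_general T hp hs0 hs1 hε hε1 (by linarith) hε1 hρ
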